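/- **Setting.** Let $\mathbf X=(\mathbf X_{\pi(0)},\mathbf X_\Omega)$ be the endogenous variables of a linear Gaussian structural causal model $$\mathbf X := A\mathbf X+\mathbf U+\mathbf i,\qquad A=\begin{bmatrix}A_{00}&A_{0\Omega}\\ 0&A_{\Omega\Omega}\end{bmatrix},$$ which has a unique solution $\mathbf X$ for almost every value of $\mathbf U$ (cycles are allowed). Here $\mathbf U$ is jointly Gaussian with $U_k\sim\mathcal N(\mu_k,\sigma_k^2)$, $\sigma_k>0$, and $\mathbf U_{\pi(0)}$ is independent of $\mathbf U_\Omega$. The shift $\mathbf i$ is drawn from a prior $P(\mathbf i)$, and $\Omega$ is exactly the set of variables that are shifted by a non-zero amount with non-zero probability. Assume one of the following. 1. $P(\mathbf i_\Omega)$ has a density with respect to Lebesgue measure, and its support contains a neighbourhood of $0$. 2. $P(\mathbf i_\Omega=0)>0$, and there are $\#\Omega$ linearly independent values of $\mathbf i_\Omega$ each having non-zero probability. Let $Y=\bar{\boldsymbol\tau}_0^\top\mathbf X_{\pi(0)}$ be a linear target. A *linear $n$-cause TCR* consists of the following. * An alignment: pairwise disjoint index sets $\pi(0),\pi(1),\dots,\pi(n)$,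 where $\pi(0)$ is the target block. * Vectors $\boldsymbol\tau_k,\boldsymbol\omega_k$ ($1\le k\le n$) supported in $\pi(k)$, such that the linear maps $\tau:\mathbf x\mapsto(\bar{\boldsymbol\tau}_0^\top\mathbf x_{\pi(0)},\boldsymbol\tau_1^\top\mathbf x,\dots,\boldsymbol\tau_n^\top\mathbf x)$ and $\omega:\mathbf i\mapsto(\boldsymbol\omega_1^\top\mathbf i,\dots,\boldsymbol\omega_n^\top\mathbf i)$ are surjective onto $\mathbb R^{n+1}$ and $\mathbb R^n$. * A high-level model $Z_k:=R_k+j_k$, $Y:=\sum_k\alpha_kZ_k+R_0+\beta$ with mutually independent exogenous variables $R_0,\dots,R_n$ and shift interventions $\mathbf j$ on the causes, whose law of $(Y,\mathbf Z)$ is denoted $P^{(\mathbf j)}$. Its consistency loss is $$\mathcal L_{\rm cons}=\mathbb E_{\mathbf i\sim P(\mathbf i)}\big[\mathrm{KL}\big(\tau_\#P^{(\mathbf i)}(\mathbf X)\,\big\|\,P^{(\omega(\mathbf i))}(Y,\mathbf Z)\big)\big].$$ Two linear $n$-cause TCRs *agree up to rescaling and permutation of the causes* if, after a permutation of the causes,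 each cause of the second is a non-zero multiple $c_k$ of that of the first: $\boldsymbol\tau_k$ and $\boldsymbol\omega_k$ are multiplied by $c_k$, $\alpha_k$ is divided by $c_k$, the law of $R_k$ becomes that of $c_kR_k$, and the law of $R_0+\beta$ is the same. **Proposition.** Put $$\bar{\boldsymbol\tau}_1=A_{0\Omega}^\top(I-A_{00})^{-\top}\bar{\boldsymbol\tau}_0,\qquad \bar{\boldsymbol\omega}_1=(I-A_{\Omega\Omega})^{-\top}\bar{\boldsymbol\tau}_1,$$ and assume $\bar{\boldsymbol\tau}_1\neq0$ (the intervened variables influence $Y$). (a) There is a linear $1$-cause TCR with $\mathcal L_{\rm cons}=0$, and it is unique up to rescaling. It is given by $\pi(1)=\Omega$ and the vectors $\bar{\boldsymbol\tau}_1$, $\bar{\boldsymbol\omega}_1$ on $\Omega$. (If $\pi(1)\subsetneq\Omega$, vectors are extended by zero.) (b) There is a maximal number $n_{\max}$ of causes such that a linear $n_{\max}$-cause TCR with all $\alpha_k\ne0$ achieves $\mathcal L_{\rm cons}=0$. Suppose moreover that the components of $\mathbf U_\Omega$ are mutually independent and that there are no cancellations among the causal pathways from each node $r\in\Omega$ towards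 $Y$, in the following sense. The pathways from $r$ to $Y$ whose last node in $\Omega$ is $s$ have joint linear coefficient $(\bar{\boldsymbol\tau}_1)_s\,\big[(I-A_{\Omega\Omega})^{-1}\big]_{sr}$, and for each $r$ no nonempty family of non-zero coefficients among these (over distinct $s\in\Omega$) sums to zero. Then any two linear $n_{\max}$-cause TCRs with all $\alpha_k\neq0$ and $\mathcal L_{\rm cons}=0$ agree up to rescaling and permutation of the causes. -/

import Mathlib

open MeasureTheory ProbabilityTheory Matrix Topology
open scoped ENNReal NNReal

namespace TCR

noncomputable section

/-! ### Linear low-level structural causal models with shift interventions -/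

section LowLevel

variable {ι : Type*} [Fintype ι]

/-- The solution `x` of the linear structural equations `x = A x + u`, when there is one. -/
def solve (A : Matrix ι ι ℝ) (u : ι → ℝ) : ι → ℝ :=
  Classical.epsilon fun x => x = A *ᵥ x + u

/-- The linear SCM with structure matrix `A` and exogenous law `PU` is uniquely solvable: for almost
every value `u` of the exogenous variables the structural equations have exactly one solution. -/
def UniquelySolvable (A : Matrix ι ι ℝ) (PU : Measure (ι → ℝ)) : Prop :=
  ∀ᵐ u ∂PU, ∃! x : ι → ℝ, x = A *ᵥ x + u

/-- The interventional law of the endogenous vector `X := A X + U + i`, where `U` has law `PU`,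
under the shift intervention with parameter vector `i`. -/
def lowLaw (A : Matrix ι ι ℝ) (PU : Measure (ι → ℝ)) (i : ι → ℝ) : Measure (ι → ℝ) :=
  PU.map fun u => solve A (u + i)

/-- The set of variables that are intervened on with non-zero probability under the prior `P`. -/
def intervenedSet (P : Measure (ι → ℝ)) : Set ι :=
  {k | P {i | i k ≠ 0} ≠ 0}

end LowLevel

/-! ### Linear `n`-cause reductions

The low-level variables are indexed by `m ⊕ w`: the block `m` is the target block `π(0)`, and the
block `w` is the set `Ω` of intervened variables. -/

section Reduction

variable {m w : Type*} [Fintype m] [Fintype w]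

/-- A linear `n`-cause targeted causal reduction for the target `Y = ∑ k, τ₀ k * X k`: the constructive
linear maps `τ` and `ω` with their common alignment `π`, and the parameters of the high-level model
`Z k := R k + j k`, `Y := ∑ k, α k * Z k + R₀ + β`, with independent exogenous `R₀, R 0, …, R (n-1)`.
The target cannot be intervened on directly. -/
structure LinearReduction (τ₀ : m → ℝ) (n : ℕ) where
  /-- the alignment; the index `0` is the target, the index `k.succ` the `k`-th cause -/
  π : Fin (n + 1) → Set (m ⊕ w)
  π_zero : π 0 = Set.range Sum.inl
  π_disjoint : ∀ k l, k ≠ l → Disjoint (π k) (π l)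
  /-- the vector that defines the `k`-th high-level cause -/
  τ : Fin n → m ⊕ w → ℝ
  τ_support : ∀ k, Function.support (τ k) ⊆ π k.succ
  /-- the vector that defines the high-level intervention on the `k`-th cause -/
  ω : Fin n → m ⊕ w → ℝ
  ω_support : ∀ k, Function.support (ω k) ⊆ π k.succ
  τ_surjective : Function.Surjective
    fun x : m ⊕ w → ℝ => ((∑ k, τ₀ k * x (Sum.inl k), fun k => τ k ⬝ᵥ x) : ℝ × (Fin n → ℝ))
  ω_surjective : Function.Surjective fun i : m ⊕ w → ℝ => fun k => ω k ⬝ᵥ i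
  /-- the coefficients of the affine high-level mechanism -/
  α : Fin n → ℝ
  /-- the offset of the affine high-level mechanism -/
  β : ℝ
  /-- the law of the exogenous variable of the target -/
  lawR₀ : Measure ℝ
  /-- the laws of the exogenous variables of the causes -/
  lawR : Fin n → Measure ℝ
  prob_lawR₀ : IsProbabilityMeasure lawR₀
  prob_lawR : ∀ k, IsProbabilityMeasure (lawR k)

namespace LinearReduction

variable {τ₀ : m → ℝ} {n : ℕ}

/-- The map from low-level to high-level endogenous variables `(Y, Z)`. -/
def tauMap (T : LinearReduction (w := w) τ₀ n) (x : m ⊕ w → ℝ) : ℝ × (Fin n → ℝ) :=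
  (∑ k, τ₀ k * x (Sum.inl k), fun k => T.τ k ⬝ᵥ x)

/-- The map from low-level to high-level shift interventions. -/
def omegaMap (T : LinearReduction (w := w) τ₀ n) (i : m ⊕ w → ℝ) : Fin n → ℝ :=
  fun k => T.ω k ⬝ᵥ i

/-- The law of `(Y, Z)` in the high-level model under the shift intervention `j` on the causes. -/
def highLaw (T : LinearReduction (w := w) τ₀ n) (j : Fin n → ℝ) : Measure (ℝ × (Fin n → ℝ)) :=
  (T.lawR₀.prod (Measure.pi T.lawR)).map
    fun r => (∑ k, T.α k * (r.2 k + j k) + r.1 + T.β, r.2 + j)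

/-- The consistency loss: the expected Kullback-Leibler divergence, over the prior `P` of the
interventions, of the push-forward of the low-level interventional law from the high-level one. -/
def consistencyLoss (T : LinearReduction (w := w) τ₀ n) (A : Matrix (m ⊕ w) (m ⊕ w) ℝ)
    (PU P : Measure (m ⊕ w → ℝ)) : ℝ≥0∞ :=
  ∫⁻ i, InformationTheory.klDiv ((lowLaw A PU i).map T.tauMap) (T.highLaw (T.omegaMap i)) ∂P

/-- Every high-level variable `Z k` is a cause of the target `Y` in the high-level model. -/
def AllCausesActive (T : LinearReduction (w := w) τ₀ n) : Prop :=
  ∀ k, T.α k ≠ 0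

/-- Two reductions agree up to rescaling and permutation of the causes: after a permutation `σ`,
each cause of the second is `c k` times the cause of the first, with the vectors `τ` and `ω`, the
coefficients and the exogenous laws changed accordingly. The laws of `R₀ + β` agree (`R₀` and `β`
separately are determined only up to an additive constant). -/
def EquivUpToScalingAndPerm (T T' : LinearReduction (w := w) τ₀ n) : Prop :=
  ∃ (σ : Equiv.Perm (Fin n)) (c : Fin n → ℝ),
    (∀ k, c k ≠ 0) ∧
    (∀ k, T'.τ k = c k • T.τ (σ k)) ∧
    (∀ k, T'.ω k = c k • T.ω (σ k)) ∧
    (∀ k, T'.α k * c k = T.α (σ k)) ∧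
    (∀ k, T'.lawR k = (T.lawR (σ k)).map fun r => c k * r) ∧
    T'.lawR₀.map (fun r => r + T'.β) = T.lawR₀.map (fun r => r + T.β)

end LinearReduction

/-! ### The prior of the interventions -/

/-- The law of the subvector `i_Ω` of the interventions. -/
def priorOn (P : Measure (m ⊕ w → ℝ)) : Measure (w → ℝ) :=
  P.map fun i k => i (Sum.inr k)

/-- The law of `i_Ω` has a density with respect to Lebesgue measure, and its support contains a
neighbourhood of zero. -/
def DensityPrior (P : Measure (m ⊕ w → ℝ)) : Prop :=
  priorOn P ≪ volume ∧ (priorOn P).support ∈ 𝓝 (0 : w → ℝ)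

/-- The value `i_Ω = 0` has non-zero probability, and so have `#Ω` values of `i_Ω` that form a family
of full rank `#Ω`. -/
def AtomicPrior (P : Measure (m ⊕ w → ℝ)) : Prop :=
  priorOn P {0} ≠ 0 ∧
    ∃ v : w → w → ℝ, LinearIndependent ℝ v ∧ ∀ k, priorOn P {v k} ≠ 0

/-! ### The explicit solution and causal pathways -/

variable [DecidableEq m] [DecidableEq w]

/-- The vector `A_{0Ω}ᵀ (I - A₀₀)⁻ᵀ τ₀`: the entry at `k` is the influence of `X k` on the target that
does not pass through another variable of `Ω`. -/
def tauBar (A₀₀ : Matrix m m ℝ) (A₀Ω : Matrix m w ℝ) (τ₀ : m → ℝ) : w → ℝ :=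
  A₀Ωᵀ *ᵥ (((1 - A₀₀)⁻¹)ᵀ *ᵥ τ₀)

/-- The vector `(I - A_{ΩΩ})⁻ᵀ τ₁`. -/
def omegaBar (A₀₀ : Matrix m m ℝ) (A₀Ω : Matrix m w ℝ) (AΩΩ : Matrix w w ℝ) (τ₀ : m → ℝ) :
    w → ℝ :=
  ((1 - AΩΩ)⁻¹)ᵀ *ᵥ tauBar A₀₀ A₀Ω τ₀

/-- The joint linear coefficient of all the causal pathways from `X r` to the target whose last
variable in `Ω` is `X s`. There are no arrows from `π(0)` to `Ω`, so every pathway from `X r` leaves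
`Ω` exactly once. The total coefficient of `X r` is the sum over `s`, which is the entry of
`omegaBar` at `r`. -/
def pathwayInfluence (A₀₀ : Matrix m m ℝ) (A₀Ω : Matrix m w ℝ) (AΩΩ : Matrix w w ℝ) (τ₀ : m → ℝ)
    (r s : w) : ℝ :=
  tauBar A₀₀ A₀Ω τ₀ s * (1 - AΩΩ)⁻¹ s r

/-- No cancellations among the causal pathways from each variable in `Ω` towards the target: no
family of pathways with non-zero coefficients, grouped according to the variable through which they
leave `Ω`, has coefficients that sum to zero. Pathways are grouped because with cycles there may be
infinitely many; in an acyclic model this is implied by the absence of vanishing sums over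
nonempty families of single directed paths. -/
def NoCancellation (A₀₀ : Matrix m m ℝ) (A₀Ω : Matrix m w ℝ) (AΩΩ : Matrix w w ℝ) (τ₀ : m → ℝ) :
    Prop :=
  ∀ (r : w) (S : Finset w), S.Nonempty →
    (∀ s ∈ S, pathwayInfluence A₀₀ A₀Ω AΩΩ τ₀ r s ≠ 0) →
      ∑ s ∈ S, pathwayInfluence A₀₀ A₀Ω AΩΩ τ₀ r s ≠ 0

end Reduction

end

end TCR

/-!
The causes of a reduction only involve `X_Ω = G (U_Ω + i_Ω)` with `G = (1 - A_{ΩΩ})⁻¹`, and the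
target is `τ̄₁ ⬝ X_Ω` plus a linear function of the exogenous variables of the target block, which are
independent of `U_Ω`. The loss vanishes if and only if for almost every `i` the two laws agree.
Subtracting the high-level mechanism from both sides turns this into the statement that one Gaussian
law, translated by a vector that depends linearly on `i`, is almost surely the same product law.
Distinct translates of a Gaussian law are distinct and neither kind of prior is concentrated on a
hyperplane, so the translation vanishes identically. This is
`TCR.LinearReduction.consistencyLoss_eq_zero_iff`: a reduction is consistent if and only if
`∑ k, α k • τ k = τ̄₁`, `ω k = Gᵀ τ k`, and the residuals have the product law of the high-level noise.
Hence a consistent reduction is determined by the vectors `τ k`, and conversely a splitting of `τ̄₁`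
into vectors with compatible blocks and independent causes gives a consistent reduction
(`TCR.exists_consistent_reduction`). For one cause, `τ̄₁` itself is the only choice up to scaling.

For several causes, the vectors `α k • τ k` are the restrictions of `τ̄₁` to disjoint blocks. If
pathways do not cancel, the block of a cause that depends on `X s` contains all variables that
influence the target through `s` (`TCR.LinearReduction.reach_subset_block`), and if the `U_Ω` are
independent, this condition on the blocks is also sufficient
(`TCR.exists_consistent_reduction_of_label`). The common refinement of two admissible partitions of
the support of `τ̄₁` is therefore admissible, so with the maximal number of causes no block can be
split by another partition (`TCR.mem_block_of_maximal`), and the two partitions coincide.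
-/

namespace TCR

/-! ### Consistency loss and equality of laws -/

section Measure

/-- The Kullback-Leibler divergence of two kernels is measurable in the parameter, because the kernel
Radon-Nikodym derivative is jointly measurable. -/
lemma measurable_klDiv_kernel {α γ : Type*} [MeasurableSpace α] [MeasurableSpace γ]
    [MeasurableSpace.CountableOrCountablyGenerated α γ] (κ η : Kernel α γ)
    [IsFiniteKernel κ] [IsFiniteKernel η] :
    Measurable fun a => InformationTheory.klDiv (κ a) (η a) := by
  classical
  have h : (fun a => InformationTheory.klDiv (κ a) (η a)) = fun a =>
      if κ a ≪ η a then
        ∫⁻ x, ENNReal.ofReal (InformationTheory.klFun (κ.rnDeriv η a x).toReal) ∂η a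
      else ∞ := by
    ext a
    rw [InformationTheory.klDiv_eq_lintegral_klFun]
    congr 1
    refine lintegral_congr_ae ?_
    filter_upwards [Kernel.rnDeriv_eq_rnDeriv_measure (κ := κ) (η := η) (a := a)] with x hx
    rw [hx]
  rw [h]
  refine Measurable.ite (Kernel.measurableSet_absolutelyContinuous κ η) ?_ measurable_const
  refine Measurable.lintegral_kernel_prod_right' (κ := η)
    (f := fun p : α × γ => ENNReal.ofReal (InformationTheory.klFun (κ.rnDeriv η p.1 p.2).toReal)) ?_
  exact (InformationTheory.measurable_klFun.comp
    (Kernel.measurable_rnDeriv κ η).ennreal_toReal).ennreal_ofReal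

lemma measurable_map_uncurry {α β γ : Type*} [MeasurableSpace α] [MeasurableSpace β]
    [MeasurableSpace γ] (M : Measure β) [SFinite M] {F : α → β → γ}
    (hF : Measurable (Function.uncurry F)) : Measurable fun a => M.map (F a) := by
  refine Measure.measurable_of_measurable_coe _ fun s hs => ?_
  have h : (fun a => M.map (F a) s) = fun a => M (Prod.mk a ⁻¹' (Function.uncurry F ⁻¹' s)) := by
    ext a
    have hFa : Measurable (F a) := hF.comp measurable_prodMk_left
    rw [Measure.map_apply hFa hs]
    rfl
  rw [h]
  exact measurable_measure_prodMk_left (hF hs)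

/-- The expected divergence of two parametrised families vanishes exactly if almost all of the laws
agree. Measurability of the divergence is essential for the forward direction, since `∫⁻` is a lower
integral. -/
lemma lintegral_klDiv_map_eq_zero_iff {α β β' γ : Type*} [MeasurableSpace α] [MeasurableSpace β]
    [MeasurableSpace β'] [MeasurableSpace γ] [MeasurableSpace.CountableOrCountablyGenerated α γ]
    (P : Measure α) (M : Measure β) [IsProbabilityMeasure M] (N : Measure β')
    [IsProbabilityMeasure N] {F : α → β → γ} {H : α → β' → γ}
    (hF : Measurable (Function.uncurry F)) (hH : Measurable (Function.uncurry H)) :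
    ∫⁻ a, InformationTheory.klDiv (M.map (F a)) (N.map (H a)) ∂P = 0 ↔
      ∀ᵐ a ∂P, M.map (F a) = N.map (H a) := by
  have hFa (a : α) : IsProbabilityMeasure (M.map (F a)) :=
    Measure.isProbabilityMeasure_map (hF.comp measurable_prodMk_left).aemeasurable
  have hHa (a : α) : IsProbabilityMeasure (N.map (H a)) :=
    Measure.isProbabilityMeasure_map (hH.comp measurable_prodMk_left).aemeasurable
  let κ : Kernel α γ := ⟨fun a => M.map (F a), measurable_map_uncurry M hF⟩
  let η : Kernel α γ := ⟨fun a => N.map (H a), measurable_map_uncurry N hH⟩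
  have : IsMarkovKernel κ := ⟨hFa⟩
  have : IsMarkovKernel η := ⟨hHa⟩
  refine (lintegral_eq_zero_iff (measurable_klDiv_kernel κ η)).trans ?_
  refine Filter.eventually_congr (.of_forall fun a => ?_)
  exact InformationTheory.klDiv_eq_zero_iff

/-- Different translations of a Gaussian law give different laws, as their means differ. -/
lemma eq_of_map_add_right_eq {E : Type*} [NormedAddCommGroup E] [NormedSpace ℝ E]
    [CompleteSpace E] [SecondCountableTopology E] [MeasurableSpace E] [BorelSpace E]
    (M : Measure E) [IsGaussian M] {v v' : E}
    (h : M.map (fun x => x + v) = M.map (fun x => x + v')) : v = v' := by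
  have key (c : E) : ∫ x, x ∂(M.map fun x => x + c) = ∫ x, x ∂M + c := by
    rw [integral_map (by fun_prop) (by fun_prop),
      integral_add (f := fun x => x) IsGaussian.integrable_id (integrable_const c)]
    simp
  have := key v
  rw [h, key v'] at this
  exact (add_left_cancel this).symm

lemma map_injective_of_leftInverse {α β : Type*} [MeasurableSpace α] [MeasurableSpace β]
    {f : α → β} {g : β → α} (hf : Measurable f) (hg : Measurable g)
    (h : Function.LeftInverse g f) {M N : Measure α} : M.map f = N.map f ↔ M = N := by
  refine ⟨fun e => ?_, fun e => by rw [e]⟩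
  have := congrArg (Measure.map g) e
  rwa [Measure.map_map hg hf, Measure.map_map hg hf, h.comp_eq_id, Measure.map_id,
    Measure.map_id] at this

end Measure

/-! ### Nondegeneracy of the prior -/

section Prior

variable {m w : Type*}

lemma ae_inl_eq_zero [Fintype m] {P : Measure (m ⊕ w → ℝ)} (hΩ : intervenedSet P = Set.range Sum.inr) :
    ∀ᵐ i ∂P, ∀ k, i (Sum.inl k) = 0 := by
  rw [ae_all_iff]
  intro k
  have h : (Sum.inl k : m ⊕ w) ∉ intervenedSet P := by simp [hΩ]
  simpa [intervenedSet, ae_iff] using h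

/-- Neither kind of prior is concentrated on an affine hyperplane. -/
lemma eq_zero_of_ae_dotProduct_eq [Fintype w] {P : Measure (m ⊕ w → ℝ)} [IsProbabilityMeasure P]
    (hprior : DensityPrior P ∨ AtomicPrior P) {f : w → ℝ} {c : ℝ}
    (h : ∀ᵐ i ∂P, f ⬝ᵥ (fun k => i (Sum.inr k)) = c) : f = 0 := by
  have hmeas : Measurable fun (i : m ⊕ w → ℝ) (k : w) => i (Sum.inr k) := by fun_prop
  have hset : MeasurableSet {x : w → ℝ | f ⬝ᵥ x = c} :=
    measurableSet_eq_fun (by unfold dotProduct; fun_prop) measurable_const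
  have h' : ∀ᵐ x ∂priorOn P, f ⬝ᵥ x = c := by
    rw [priorOn, ae_map_iff hmeas.aemeasurable hset]
    exact h
  have : IsProbabilityMeasure (priorOn P) := Measure.isProbabilityMeasure_map hmeas.aemeasurable
  -- With a density, a hyperplane is a null set; with atoms, the atom at `0` forces `c = 0` and the
  -- other atoms span the whole space.
  rcases hprior with ⟨hac, -⟩ | ⟨h0, v, hv, hvP⟩
  · by_contra hf
    obtain ⟨x₀, hx₀⟩ := h'.exists
    let s : AffineSubspace ℝ (w → ℝ) :=
      AffineSubspace.mk' x₀ (LinearMap.ker (dotProductBilin ℝ ℝ f))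
    have hs : s ≠ ⊤ := by
      intro htop
      have hmem : x₀ + f ∈ s := htop ▸ AffineSubspace.mem_top ℝ _ _
      have : f ⬝ᵥ f = 0 := by simpa [s, AffineSubspace.mem_mk'] using hmem
      exact hf (dotProduct_self_eq_zero.1 this)
    have hzero : priorOn P {x | f ⬝ᵥ x = c} = 0 := by
      refine hac (measure_mono_null (fun x hx => ?_) (Measure.addHaar_affineSubspace volume s hs))
      simp only [Set.mem_ofPred_eq] at hx
      simp [s, AffineSubspace.mem_mk', dotProduct_sub, hx, hx₀]
    have hone : priorOn P {x | f ⬝ᵥ x = c} = 1 := by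
      rw [prob_compl_eq_zero_iff hset |>.symm]
      exact h'
    simp [hzero] at hone
  · have atom {x : w → ℝ} (hx : priorOn P {x} ≠ 0) : f ⬝ᵥ x = c := by
      by_contra hne
      exact hx (measure_mono_null (by simpa using hne) h')
    have hc : c = 0 := by simpa using (atom h0).symm
    have hspan := hv.span_eq_top_of_card_eq_finrank' (by simp)
    have hker : (⊤ : Submodule ℝ (w → ℝ)) ≤ LinearMap.ker (dotProductBilin ℝ ℝ f) := by
      rw [← hspan, Submodule.span_le]
      rintro _ ⟨k, rfl⟩
      simpa [hc] using atom (hvP k)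
    have : f ⬝ᵥ f = 0 := by simpa using hker (Submodule.mem_top (x := f))
    exact dotProduct_self_eq_zero.1 this

end Prior

/-! ### Solution of the structural equations -/

section Solve

variable {ι : Type*} [Fintype ι] [DecidableEq ι]

lemma eq_mulVec_add_iff (A : Matrix ι ι ℝ) (u x : ι → ℝ) :
    x = A *ᵥ x + u ↔ (1 - A) *ᵥ x = u := by
  rw [sub_mulVec, one_mulVec, sub_eq_iff_eq_add']

/-- Unique solvability at a single value of the exogenous variables already makes `1 - A`
invertible. -/
lemma UniquelySolvable.isUnit_det {A : Matrix ι ι ℝ} {PU : Measure (ι → ℝ)}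
    [IsProbabilityMeasure PU] (h : UniquelySolvable A PU) : IsUnit (1 - A).det := by
  obtain ⟨u, x, hx, hu⟩ := Filter.Eventually.exists h
  rw [isUnit_iff_ne_zero]
  intro hdet
  obtain ⟨y, hy, hy'⟩ := exists_mulVec_eq_zero_iff.2 hdet
  have hxy : x + y = A *ᵥ (x + y) + u := by
    rw [eq_mulVec_add_iff, mulVec_add, hy', add_zero, ← eq_mulVec_add_iff]
    exact hx
  exact hy (by simpa using hu _ hxy)

lemma mulVec_solve {A : Matrix ι ι ℝ} (hA : IsUnit (1 - A).det) (u : ι → ℝ) :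
    (1 - A) *ᵥ solve A u = u := by
  rw [← eq_mulVec_add_iff]
  refine Classical.epsilon_spec (p := fun x => x = A *ᵥ x + u) ⟨(1 - A)⁻¹ *ᵥ u, ?_⟩
  rw [eq_mulVec_add_iff, mulVec_mulVec, mul_nonsing_inv _ hA, one_mulVec]

lemma solve_eq {A : Matrix ι ι ℝ} (hA : IsUnit (1 - A).det) (u : ι → ℝ) :
    solve A u = (1 - A)⁻¹ *ᵥ u := by
  conv_rhs => rw [← mulVec_solve hA u, mulVec_mulVec, nonsing_inv_mul _ hA, one_mulVec]

variable {m w : Type*} [DecidableEq m] [DecidableEq w]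
  {A₀₀ : Matrix m m ℝ} {A₀Ω : Matrix m w ℝ} {AΩΩ : Matrix w w ℝ}

lemma one_sub_fromBlocks : (1 : Matrix (m ⊕ w) (m ⊕ w) ℝ) - fromBlocks A₀₀ A₀Ω 0 AΩΩ =
    fromBlocks (1 - A₀₀) (-A₀Ω) 0 (1 - AΩΩ) := by
  rw [← fromBlocks_one, sub_eq_add_neg, fromBlocks_neg, fromBlocks_add]
  simp [sub_eq_add_neg]

variable [Fintype m] [Fintype w]

lemma isUnit_det_one_sub_fromBlocks :
    IsUnit (1 - fromBlocks A₀₀ A₀Ω 0 AΩΩ).det ↔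
      IsUnit (1 - A₀₀).det ∧ IsUnit (1 - AΩΩ).det := by
  rw [one_sub_fromBlocks, det_fromBlocks_zero₂₁, IsUnit.mul_iff]

lemma solve_fromBlocks_inr (h₀ : IsUnit (1 - A₀₀).det) (h₁ : IsUnit (1 - AΩΩ).det)
    (u : m ⊕ w → ℝ) :
    solve (fromBlocks A₀₀ A₀Ω 0 AΩΩ) u ∘ Sum.inr = (1 - AΩΩ)⁻¹ *ᵥ (u ∘ Sum.inr) := by
  have h := mulVec_solve (A := fromBlocks A₀₀ A₀Ω 0 AΩΩ)
    (isUnit_det_one_sub_fromBlocks.2 ⟨h₀, h₁⟩) u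
  rw [one_sub_fromBlocks, fromBlocks_mulVec] at h
  conv_rhs => rw [← h]
  simp [Sum.elim_comp_inr, nonsing_inv_mul _ h₁]

lemma solve_fromBlocks_inl (h₀ : IsUnit (1 - A₀₀).det) (h₁ : IsUnit (1 - AΩΩ).det)
    (u : m ⊕ w → ℝ) :
    solve (fromBlocks A₀₀ A₀Ω 0 AΩΩ) u ∘ Sum.inl =
      (1 - A₀₀)⁻¹ *ᵥ (A₀Ω *ᵥ ((1 - AΩΩ)⁻¹ *ᵥ (u ∘ Sum.inr)) + u ∘ Sum.inl) := by
  have h := mulVec_solve (A := fromBlocks A₀₀ A₀Ω 0 AΩΩ)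
    (isUnit_det_one_sub_fromBlocks.2 ⟨h₀, h₁⟩) u
  rw [one_sub_fromBlocks, fromBlocks_mulVec] at h
  have h' := congrArg (fun x => x ∘ Sum.inl) h
  simp only [Sum.elim_comp_inl] at h'
  rw [← h', ← solve_fromBlocks_inr h₀ h₁ (A₀Ω := A₀Ω) u, neg_mulVec]
  simp [nonsing_inv_mul _ h₀]

end Solve

/-! ### High-level laws and low-level residuals -/

section Residual

variable {m w : Type*} [Fintype m] [Fintype w]

namespace LinearReduction

variable {τ₀ : m → ℝ} {n : ℕ} (T : LinearReduction (w := w) τ₀ n)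

/-- The vector that defines the `k`-th cause, restricted to the intervened variables; it vanishes on
the target block. -/
def causeVec (k : Fin n) : w → ℝ := T.τ k ∘ Sum.inr

/-- The vector that defines the intervention on the `k`-th cause, restricted to the intervened
variables; it vanishes on the target block. -/
def shiftVec (k : Fin n) : w → ℝ := T.ω k ∘ Sum.inr

lemma inl_notMem_π_succ (k : Fin n) (a : m) : (Sum.inl a : m ⊕ w) ∉ T.π k.succ := by
  have h := T.π_disjoint 0 k.succ (Fin.succ_ne_zero k).symm
  rw [T.π_zero] at h
  exact Set.disjoint_left.1 h ⟨a, rfl⟩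

@[simp]
lemma τ_inl (k : Fin n) (a : m) : T.τ k (Sum.inl a) = 0 := by
  by_contra h
  exact T.inl_notMem_π_succ k a (T.τ_support k h)

@[simp]
lemma ω_inl (k : Fin n) (a : m) : T.ω k (Sum.inl a) = 0 := by
  by_contra h
  exact T.inl_notMem_π_succ k a (T.ω_support k h)

lemma τ_dotProduct (k : Fin n) (x : m ⊕ w → ℝ) : T.τ k ⬝ᵥ x = T.causeVec k ⬝ᵥ (x ∘ Sum.inr) := by
  simp [dotProduct, causeVec]

lemma ω_dotProduct (k : Fin n) (x : m ⊕ w → ℝ) : T.ω k ⬝ᵥ x = T.shiftVec k ⬝ᵥ (x ∘ Sum.inr) := by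
  simp [dotProduct, shiftVec]

lemma causeVec_ne_zero (k : Fin n) : T.causeVec k ≠ 0 := by
  intro h
  obtain ⟨x, hx⟩ := T.τ_surjective (0, 1)
  have := congrFun (congrArg Prod.snd hx) k
  simp [τ_dotProduct, h] at this

/-- The high-level law of `(R₀ + β, R)`: the part of the high-level model that no intervention
changes. -/
noncomputable def noiseLaw : Measure (ℝ × (Fin n → ℝ)) :=
  (T.lawR₀.map (· + T.β)).prod (Measure.pi T.lawR)

/-- The affine map that sends `(R₀ + β, R)` to `(Y, Z)` under the intervention `j`. -/
def mechanism (j : Fin n → ℝ) (r : ℝ × (Fin n → ℝ)) : ℝ × (Fin n → ℝ) :=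
  (r.1 + ∑ k, T.α k * (r.2 k + j k), r.2 + j)

lemma measurable_uncurry_mechanism : Measurable (Function.uncurry T.mechanism) := by
  unfold mechanism Function.uncurry
  fun_prop

lemma measurable_mechanism (j : Fin n → ℝ) : Measurable (T.mechanism j) :=
  T.measurable_uncurry_mechanism.comp measurable_prodMk_left

lemma map_mechanism_inj (j : Fin n → ℝ) {M N : Measure (ℝ × (Fin n → ℝ))} :
    M.map (T.mechanism j) = N.map (T.mechanism j) ↔ M = N := by
  refine map_injective_of_leftInverse (T.measurable_mechanism j)
    (g := fun y => (y.1 - ∑ k, T.α k * y.2 k, y.2 - j)) (by fun_prop) fun r => ?_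
  simp [mechanism]

lemma measurable_omegaMap : Measurable T.omegaMap := by
  unfold omegaMap dotProduct
  fun_prop

instance : IsProbabilityMeasure T.lawR₀ := T.prob_lawR₀
instance (k : Fin n) : IsProbabilityMeasure (T.lawR k) := T.prob_lawR k
instance : IsProbabilityMeasure (T.lawR₀.map (· + T.β)) :=
  Measure.isProbabilityMeasure_map (by fun_prop)
instance : IsProbabilityMeasure T.noiseLaw := by unfold noiseLaw; infer_instance

lemma highLaw_eq (j : Fin n → ℝ) : T.highLaw j = T.noiseLaw.map (T.mechanism j) := by
  have h : T.noiseLaw =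
      (T.lawR₀.prod (Measure.pi T.lawR)).map (Prod.map (· + T.β) id) := by
    rw [noiseLaw, ← Measure.map_prod_map _ _ (by fun_prop) measurable_id, Measure.map_id]
  rw [h, Measure.map_map (T.measurable_mechanism j) (by fun_prop), highLaw]
  congr 1
  ext r : 1
  simp only [mechanism, Function.comp_apply, Prod.map_fst, Prod.map_snd, id_eq, Prod.mk.injEq,
    and_true]
  ring

end LinearReduction

variable [DecidableEq m] [DecidableEq w] (A₀₀ : Matrix m m ℝ) (A₀Ω : Matrix m w ℝ)
  (AΩΩ : Matrix w w ℝ)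

/-- The coefficients of the exogenous variables of the target block in the target. -/
noncomputable def targetNoise (τ₀ : m → ℝ) : m → ℝ := ((1 - A₀₀)⁻¹)ᵀ *ᵥ τ₀

/-- The coefficients, in terms of the exogenous variables of `Ω`, of the linear functional of `X_Ω`
with coefficients `t`. -/
noncomputable def pullback (t : w → ℝ) : w → ℝ := ((1 - AΩΩ)⁻¹)ᵀ *ᵥ t

variable {A₀₀ A₀Ω AΩΩ}

lemma pullback_injective (h₁ : IsUnit (1 - AΩΩ).det) : Function.Injective (pullback AΩΩ) := by
  refine Function.LeftInverse.injective (g := fun t => (1 - AΩΩ)ᵀ *ᵥ t) fun t => ?_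
  simp only [pullback]
  rw [mulVec_mulVec, ← transpose_mul, nonsing_inv_mul _ h₁, transpose_one, one_mulVec]

lemma pullback_dotProduct (t v : w → ℝ) :
    pullback AΩΩ t ⬝ᵥ v = t ⬝ᵥ ((1 - AΩΩ)⁻¹ *ᵥ v) := by
  rw [pullback, mulVec_transpose, dotProduct_mulVec]

lemma pullback_smul (c : ℝ) (t : w → ℝ) : pullback AΩΩ (c • t) = c • pullback AΩΩ t :=
  mulVec_smul _ _ _

lemma target_solve (h₀ : IsUnit (1 - A₀₀).det) (h₁ : IsUnit (1 - AΩΩ).det) (τ₀ : m → ℝ)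
    (v : m ⊕ w → ℝ) :
    ∑ k, τ₀ k * solve (fromBlocks A₀₀ A₀Ω 0 AΩΩ) v (Sum.inl k) =
      pullback AΩΩ (tauBar A₀₀ A₀Ω τ₀) ⬝ᵥ (v ∘ Sum.inr) +
        targetNoise A₀₀ τ₀ ⬝ᵥ (v ∘ Sum.inl) := by
  change τ₀ ⬝ᵥ (solve (fromBlocks A₀₀ A₀Ω 0 AΩΩ) v ∘ Sum.inl) = _
  rw [solve_fromBlocks_inl h₀ h₁, pullback_dotProduct, tauBar, targetNoise, mulVec_transpose,
    mulVec_transpose, ← dotProduct_mulVec, ← dotProduct_mulVec, ← dotProduct_mulVec, mulVec_add,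
    dotProduct_add]

namespace LinearReduction

variable {τ₀ : m → ℝ} {n : ℕ} (T : LinearReduction (w := w) τ₀ n)

/-- The low-level variables `(Y - ∑ k, α k * Z k, Z)` without interventions, as linear functions of
the exogenous variables. -/
noncomputable def residual (A₀₀ : Matrix m m ℝ) (A₀Ω : Matrix m w ℝ) (AΩΩ : Matrix w w ℝ) :
    (m ⊕ w → ℝ) →ₗ[ℝ] ℝ × (Fin n → ℝ) where
  toFun u := (pullback AΩΩ (tauBar A₀₀ A₀Ω τ₀ - ∑ k, T.α k • T.causeVec k) ⬝ᵥ (u ∘ Sum.inr) +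
    targetNoise A₀₀ τ₀ ⬝ᵥ (u ∘ Sum.inl), fun k => pullback AΩΩ (T.causeVec k) ⬝ᵥ (u ∘ Sum.inr))
  map_add' u v := by
    have h₁ : (u + v) ∘ Sum.inr = (u ∘ Sum.inr + v ∘ Sum.inr : w → ℝ) := rfl
    have h₂ : (u + v) ∘ Sum.inl = (u ∘ Sum.inl + v ∘ Sum.inl : m → ℝ) := rfl
    ext
    · simp only [h₁, h₂, dotProduct_add, Prod.fst_add]
      ring
    · simp [h₁, dotProduct_add]
  map_smul' c u := by
    have h₁ : (c • u) ∘ Sum.inr = (c • (u ∘ Sum.inr) : w → ℝ) := rfl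
    have h₂ : (c • u) ∘ Sum.inl = (c • (u ∘ Sum.inl) : m → ℝ) := rfl
    ext
    · simp [h₁, h₂, mul_add]
    · simp [h₁]

lemma measurable_residual : Measurable (T.residual A₀₀ A₀Ω AΩΩ) :=
  (LinearMap.continuous_of_finiteDimensional _).measurable

lemma tauMap_solve (h₀ : IsUnit (1 - A₀₀).det) (h₁ : IsUnit (1 - AΩΩ).det)
    (v : m ⊕ w → ℝ) (j : Fin n → ℝ) :
    T.tauMap (solve (fromBlocks A₀₀ A₀Ω 0 AΩΩ) v) =
      T.mechanism j (T.residual A₀₀ A₀Ω AΩΩ v - (0, j)) := by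
  have hZ (k : Fin n) : T.τ k ⬝ᵥ solve (fromBlocks A₀₀ A₀Ω 0 AΩΩ) v =
      pullback AΩΩ (T.causeVec k) ⬝ᵥ (v ∘ Sum.inr) := by
    rw [τ_dotProduct, solve_fromBlocks_inr h₀ h₁, pullback_dotProduct]
  ext
  · simp only [tauMap, target_solve h₀ h₁, mechanism, residual, LinearMap.coe_mk, AddHom.coe_mk,
      Prod.fst_sub, Prod.snd_sub, sub_zero, Pi.sub_apply, sub_add_cancel]
    simp only [pullback_dotProduct, sub_dotProduct, sum_dotProduct, smul_dotProduct, smul_eq_mul]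
    ring
  · simp [tauMap, hZ, mechanism, residual]

lemma map_lowLaw (h₀ : IsUnit (1 - A₀₀).det) (h₁ : IsUnit (1 - AΩΩ).det)
    (PU : Measure (m ⊕ w → ℝ)) (i : m ⊕ w → ℝ) :
    (lowLaw (fromBlocks A₀₀ A₀Ω 0 AΩΩ) PU i).map T.tauMap =
      PU.map fun u => T.mechanism (T.omegaMap i)
        (T.residual A₀₀ A₀Ω AΩΩ (u + i) - (0, T.omegaMap i)) := by
  have hA := isUnit_det_one_sub_fromBlocks (A₀Ω := A₀Ω).2 ⟨h₀, h₁⟩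
  rw [lowLaw, Measure.map_map]
  · congr 1
    ext u : 1
    exact T.tauMap_solve h₀ h₁ _ _
  · unfold tauMap dotProduct
    fun_prop
  · simp_rw [solve_eq hA]
    unfold mulVec dotProduct
    fun_prop

/-- The shift of the low-level variables `(Y - ∑ k, α k * Z k, Z)` under the intervention `i` that
the high-level intervention does not account for. -/
noncomputable def excess (A₀₀ : Matrix m m ℝ) (A₀Ω : Matrix m w ℝ) (AΩΩ : Matrix w w ℝ)
    (i : m ⊕ w → ℝ) : ℝ × (Fin n → ℝ) :=
  T.residual A₀₀ A₀Ω AΩΩ i - (0, T.omegaMap i)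

/-- Undoing the high-level mechanism on both sides, consistency says that for almost every
intervention the residual law, shifted by the excess, is the law of the high-level noise. -/
lemma consistencyLoss_eq_zero_iff_ae (h₀ : IsUnit (1 - A₀₀).det) (h₁ : IsUnit (1 - AΩΩ).det)
    (PU : Measure (m ⊕ w → ℝ)) [IsProbabilityMeasure PU] (P : Measure (m ⊕ w → ℝ)) :
    T.consistencyLoss (fromBlocks A₀₀ A₀Ω 0 AΩΩ) PU P = 0 ↔
      ∀ᵐ i ∂P, (PU.map (T.residual A₀₀ A₀Ω AΩΩ)).map (· + T.excess A₀₀ A₀Ω AΩΩ i) =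
        T.noiseLaw := by
  have hω := T.measurable_omegaMap
  have hr := T.measurable_residual (A₀₀ := A₀₀) (A₀Ω := A₀Ω) (AΩΩ := AΩΩ)
  have hmech := T.measurable_uncurry_mechanism
  simp_rw [consistencyLoss, T.map_lowLaw h₀ h₁, highLaw_eq]
  rw [lintegral_klDiv_map_eq_zero_iff P PU T.noiseLaw (F := fun i u => T.mechanism (T.omegaMap i)
      (T.residual A₀₀ A₀Ω AΩΩ (u + i) - (0, T.omegaMap i)))
    (H := fun i => T.mechanism (T.omegaMap i))]
  · refine Filter.eventually_congr (.of_forall fun i => ?_)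
    refine Iff.trans ?_ (T.map_mechanism_inj (T.omegaMap i))
    rw [Measure.map_map (by fun_prop) hr,
      Measure.map_map (T.measurable_mechanism _) (by fun_prop)]
    refine Eq.congr ?_ rfl
    congr 1
    ext u : 1
    simp [excess, add_sub_assoc]
  · exact hmech.comp (by fun_prop : Measurable fun p : (m ⊕ w → ℝ) × (m ⊕ w → ℝ) =>
      (T.omegaMap p.1, T.residual A₀₀ A₀Ω AΩΩ (p.2 + p.1) - (0, T.omegaMap p.1)))
  · exact hmech.comp (by fun_prop : Measurable fun p : (m ⊕ w → ℝ) × (ℝ × (Fin n → ℝ)) =>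
      (T.omegaMap p.1, p.2))

end LinearReduction

end Residual

/-! ### Characterization and construction of consistent reductions -/

section Consistent

variable {m w : Type*} [Fintype m] [Fintype w] [DecidableEq m] [DecidableEq w]
  {A₀₀ : Matrix m m ℝ} {A₀Ω : Matrix m w ℝ} {AΩΩ : Matrix w w ℝ}

namespace LinearReduction

variable {τ₀ : m → ℝ} {n : ℕ} (T : LinearReduction (w := w) τ₀ n)

/-- A reduction is consistent exactly if its causes add up to the influence on the target, the
high-level interventions reproduce the effect of the low-level ones, and the residual variables
have the product law of the high-level exogenous variables. -/
theorem consistencyLoss_eq_zero_iff (h₀ : IsUnit (1 - A₀₀).det) (h₁ : IsUnit (1 - AΩΩ).det)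
    {PU : Measure (m ⊕ w → ℝ)} [IsGaussian PU] {P : Measure (m ⊕ w → ℝ)} [IsProbabilityMeasure P]
    (hΩ : intervenedSet P = Set.range Sum.inr) (hprior : DensityPrior P ∨ AtomicPrior P) :
    T.consistencyLoss (fromBlocks A₀₀ A₀Ω 0 AΩΩ) PU P = 0 ↔
      ∑ k, T.α k • T.causeVec k = tauBar A₀₀ A₀Ω τ₀ ∧
      (∀ k, T.shiftVec k = pullback AΩΩ (T.causeVec k)) ∧
      PU.map (T.residual A₀₀ A₀Ω AΩΩ) = T.noiseLaw := by
  rw [T.consistencyLoss_eq_zero_iff_ae h₀ h₁]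
  have hfst {i : m ⊕ w → ℝ} (hi : ∀ k, i (Sum.inl k) = 0) : (T.excess A₀₀ A₀Ω AΩΩ i).1 =
      pullback AΩΩ (tauBar A₀₀ A₀Ω τ₀ - ∑ k, T.α k • T.causeVec k) ⬝ᵥ (i ∘ Sum.inr) := by
    have : i ∘ Sum.inl = (0 : m → ℝ) := funext hi
    simp [excess, residual, this]
  have hsnd (i : m ⊕ w → ℝ) (k : Fin n) : (T.excess A₀₀ A₀Ω AΩΩ i).2 k =
      (pullback AΩΩ (T.causeVec k) - T.shiftVec k) ⬝ᵥ (i ∘ Sum.inr) := by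
    simp [excess, residual, omegaMap, ω_dotProduct, sub_dotProduct]
  constructor
  · intro h
    -- All shifts of the residual law by the excess agree, so the excess, which is linear in the
    -- intervention, is almost surely constant.
    let L := (T.residual A₀₀ A₀Ω AΩΩ).toContinuousLinearMap
    have hM : IsGaussian (PU.map (T.residual A₀₀ A₀Ω AΩΩ)) := isGaussian_map (μ := PU) L
    obtain ⟨i₀, hi₀⟩ := h.exists
    have hconst : ∀ᵐ i ∂P, T.excess A₀₀ A₀Ω AΩΩ i = T.excess A₀₀ A₀Ω AΩΩ i₀ := by
      filter_upwards [h] with i hi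
      exact eq_of_map_add_right_eq _ (hi.trans hi₀.symm)
    have hd : ∑ k, T.α k • T.causeVec k = tauBar A₀₀ A₀Ω τ₀ := by
      rw [eq_comm, ← sub_eq_zero]
      apply pullback_injective h₁
      rw [pullback, pullback, mulVec_zero]
      refine eq_zero_of_ae_dotProduct_eq hprior (c := (T.excess A₀₀ A₀Ω AΩΩ i₀).1) ?_
      filter_upwards [hconst, ae_inl_eq_zero hΩ] with i hi hi0
      rw [← hi, hfst hi0]
      rfl
    have hω (k : Fin n) : T.shiftVec k = pullback AΩΩ (T.causeVec k) := by
      rw [eq_comm, ← sub_eq_zero]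
      refine eq_zero_of_ae_dotProduct_eq hprior (c := (T.excess A₀₀ A₀Ω AΩΩ i₀).2 k) ?_
      filter_upwards [hconst] with i hi
      rw [← hi, hsnd]
      rfl
    refine ⟨hd, hω, ?_⟩
    obtain ⟨i, hi, hi0⟩ := (h.and (ae_inl_eq_zero hΩ)).exists
    have hexc : T.excess A₀₀ A₀Ω AΩΩ i = 0 := by
      ext k
      · simp [hfst hi0, hd, pullback]
      · simp [hsnd, hω]
    rw [← hi, hexc]
    simp
  · rintro ⟨hd, hω, hM⟩
    filter_upwards [ae_inl_eq_zero hΩ] with i hi0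
    have hexc : T.excess A₀₀ A₀Ω AΩΩ i = 0 := by
      ext k
      · simp [hfst hi0, hd, pullback]
      · simp [hsnd, hω]
    rw [hexc, ← hM]
    simp

lemma residual_apply (hd : ∑ k, T.α k • T.causeVec k = tauBar A₀₀ A₀Ω τ₀) (u : m ⊕ w → ℝ) :
    T.residual A₀₀ A₀Ω AΩΩ u =
      (targetNoise A₀₀ τ₀ ⬝ᵥ (u ∘ Sum.inl),
        fun k => pullback AΩΩ (T.causeVec k) ⬝ᵥ (u ∘ Sum.inr)) := by
  simp [residual, hd, pullback]

variable {T} in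
lemma map_lawR₀_eq {PU : Measure (m ⊕ w → ℝ)}
    (hd : ∑ k, T.α k • T.causeVec k = tauBar A₀₀ A₀Ω τ₀)
    (hM : PU.map (T.residual A₀₀ A₀Ω AΩΩ) = T.noiseLaw) :
    T.lawR₀.map (· + T.β) = PU.map fun u => targetNoise A₀₀ τ₀ ⬝ᵥ (u ∘ Sum.inl) := by
  have h := congrArg (Measure.map Prod.fst) hM
  rw [Measure.map_map measurable_fst T.measurable_residual, noiseLaw, Measure.map_fst_prod,
    measure_univ, one_smul] at h
  rw [← h]
  congr 1
  ext u
  simp [T.residual_apply hd]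

variable {T} in
lemma lawR_eq {PU : Measure (m ⊕ w → ℝ)}
    (hM : PU.map (T.residual A₀₀ A₀Ω AΩΩ) = T.noiseLaw) (k : Fin n) :
    T.lawR k = PU.map fun u => pullback AΩΩ (T.causeVec k) ⬝ᵥ (u ∘ Sum.inr) := by
  have hcomp : (fun r : ℝ × (Fin n → ℝ) => r.2 k) = (fun z => z k) ∘ Prod.snd := rfl
  have h : T.noiseLaw.map (fun r => r.2 k) = T.lawR k := by
    rw [noiseLaw, hcomp, ← Measure.map_map (measurable_pi_apply k) measurable_snd,
      Measure.map_snd_prod, measure_univ, one_smul, (measurePreserving_eval T.lawR k).map_eq]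
  rw [← h, ← hM, Measure.map_map (by fun_prop) T.measurable_residual]
  rfl

/-- A consistent reduction is determined, up to rescaling and permutation, by its vectors `τ`. -/
theorem equivUpToScalingAndPerm_of_causeVec (h₀ : IsUnit (1 - A₀₀).det)
    (h₁ : IsUnit (1 - AΩΩ).det)
    {PU : Measure (m ⊕ w → ℝ)} [IsGaussian PU] {P : Measure (m ⊕ w → ℝ)} [IsProbabilityMeasure P]
    (hΩ : intervenedSet P = Set.range Sum.inr) (hprior : DensityPrior P ∨ AtomicPrior P)
    {T T' : LinearReduction (w := w) τ₀ n}
    (hT : T.consistencyLoss (fromBlocks A₀₀ A₀Ω 0 AΩΩ) PU P = 0)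
    (hT' : T'.consistencyLoss (fromBlocks A₀₀ A₀Ω 0 AΩΩ) PU P = 0)
    (σ : Equiv.Perm (Fin n)) (c : Fin n → ℝ) (hc : ∀ k, c k ≠ 0)
    (hτ : ∀ k, T'.causeVec k = c k • T.causeVec (σ k)) (hα : ∀ k, T'.α k * c k = T.α (σ k)) :
    T.EquivUpToScalingAndPerm T' := by
  obtain ⟨hd, hω, hM⟩ := (T.consistencyLoss_eq_zero_iff h₀ h₁ hΩ hprior).1 hT
  obtain ⟨hd', hω', hM'⟩ := (T'.consistencyLoss_eq_zero_iff h₀ h₁ hΩ hprior).1 hT'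
  refine ⟨σ, c, hc, fun k => ?_, fun k => ?_, hα, fun k => ?_, ?_⟩
  · ext (a | s)
    · simp
    · exact congrFun (hτ k) s
  · ext (a | s)
    · simp
    · have : T'.shiftVec k = c k • T.shiftVec (σ k) := by
        rw [hω', hω, hτ, pullback_smul]
      exact congrFun this s
  · rw [lawR_eq hM', lawR_eq hM, Measure.map_map (by fun_prop) (by unfold dotProduct; fun_prop)]
    congr 1
    ext u
    simp [hτ, pullback_smul]
  · rw [map_lawR₀_eq hd' hM', map_lawR₀_eq hd hM]

end LinearReduction

section Construction

lemma surjective_dotProduct_of_disjoint_support {ι κ : Type*} [Fintype κ] [Finite ι]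
    {v : ι → κ → ℝ} (hv : ∀ k, v k ≠ 0)
    (hdisj : ∀ k l, k ≠ l → Disjoint (Function.support (v k)) (Function.support (v l))) :
    Function.Surjective fun (x : κ → ℝ) (k : ι) => v k ⬝ᵥ x := by
  have := Fintype.ofFinite ι
  intro y
  have horth (k l : ι) (hkl : k ≠ l) : v k ⬝ᵥ v l = 0 := by
    refine Finset.sum_eq_zero fun s _ => ?_
    by_contra h
    exact Set.disjoint_left.1 (hdisj k l hkl) (left_ne_zero_of_mul h) (right_ne_zero_of_mul h)
  refine ⟨∑ l, (y l / (v l ⬝ᵥ v l)) • v l, ?_⟩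
  ext k
  have hk : v k ⬝ᵥ v k ≠ 0 := fun h => hv k (dotProduct_self_eq_zero.1 h)
  simp only [dotProduct_sum, dotProduct_smul, smul_eq_mul]
  rw [Finset.sum_eq_single k (fun l _ hl => by rw [horth k l hl.symm, mul_zero]) (by simp)]
  field_simp

/-- A splitting of `tauBar` into vectors whose blocks, together with the blocks of the corresponding
intervention vectors, are disjoint and whose causes are independent gives a consistent reduction. -/
theorem exists_consistent_reduction (h₀ : IsUnit (1 - A₀₀).det) (h₁ : IsUnit (1 - AΩΩ).det)
    {PU : Measure (m ⊕ w → ℝ)} [IsGaussian PU]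
    (hblocks : IndepFun (fun (u : m ⊕ w → ℝ) (k : m) => u (Sum.inl k))
      (fun (u : m ⊕ w → ℝ) (k : w) => u (Sum.inr k)) PU)
    {P : Measure (m ⊕ w → ℝ)} [IsProbabilityMeasure P]
    (hΩ : intervenedSet P = Set.range Sum.inr) (hprior : DensityPrior P ∨ AtomicPrior P)
    {τ₀ : m → ℝ} (hτ₀ : τ₀ ≠ 0) {n : ℕ} (D : Fin n → Set w)
    (hD : ∀ k l, k ≠ l → Disjoint (D k) (D l)) (t : Fin n → w → ℝ) (ht : ∀ k, t k ≠ 0)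
    (htD : ∀ k, Function.support (t k) ⊆ D k)
    (hpD : ∀ k, Function.support (pullback AΩΩ (t k)) ⊆ D k)
    (hsum : ∑ k, t k = tauBar A₀₀ A₀Ω τ₀)
    (hindep : iIndepFun (fun k (u : m ⊕ w → ℝ) => pullback AΩΩ (t k) ⬝ᵥ (u ∘ Sum.inr)) PU) :
    ∃ T : LinearReduction (w := w) τ₀ n,
      T.consistencyLoss (fromBlocks A₀₀ A₀Ω 0 AΩΩ) PU P = 0 ∧ (∀ k, T.α k = 1) ∧
      (∀ k, T.π k.succ = Sum.inr '' D k) ∧ (∀ k, T.causeVec k = t k) ∧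
      ∀ k, T.shiftVec k = pullback AΩΩ (t k) := by
  have hmeas₀ : Measurable fun u : m ⊕ w → ℝ => targetNoise A₀₀ τ₀ ⬝ᵥ (u ∘ Sum.inl) := by
    unfold dotProduct; fun_prop
  have hmeas (k : Fin n) :
      Measurable fun u : m ⊕ w → ℝ => pullback AΩΩ (t k) ⬝ᵥ (u ∘ Sum.inr) := by
    unfold dotProduct; fun_prop
  have hdot (x : m ⊕ w → ℝ) (s : w → ℝ) : (Sum.elim 0 s : m ⊕ w → ℝ) ⬝ᵥ x = s ⬝ᵥ (x ∘ Sum.inr) := by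
    simp [dotProduct]
  have hsupp {s : w → ℝ} {E : Set w} (h : Function.support s ⊆ E) :
      Function.support (Sum.elim 0 s : m ⊕ w → ℝ) ⊆ Sum.inr '' E := by
    rintro (a | a) ha
    · simp at ha
    · exact ⟨a, h ha, rfl⟩
  have hp (k : Fin n) : pullback AΩΩ (t k) ≠ 0 := by
    intro h
    refine ht k (pullback_injective h₁ (h.trans ?_))
    simp [pullback]
  have hinl (k : Fin n) : Disjoint (Set.range Sum.inl) (Sum.inr '' D k : Set (m ⊕ w)) := by
    rw [Set.disjoint_left]
    rintro _ ⟨a, rfl⟩ ⟨b, -, hb⟩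
    cases hb
  let T : LinearReduction (w := w) τ₀ n :=
    { π := Fin.cons (Set.range Sum.inl) fun k => Sum.inr '' D k
      π_zero := rfl
      π_disjoint := by
        intro k l hkl
        cases k using Fin.cases with
        | zero =>
          cases l using Fin.cases with
          | zero => exact absurd rfl hkl
          | succ l => exact hinl l
        | succ k =>
          cases l using Fin.cases with
          | zero => exact (hinl k).symm
          | succ l =>
            exact Set.disjoint_image_iff Sum.inr_injective |>.2
              (hD k l fun h => hkl (congrArg Fin.succ h))
      τ := fun k => Sum.elim 0 (t k)
      τ_support := fun k => hsupp (htD k)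
      ω := fun k => Sum.elim 0 (pullback AΩΩ (t k))
      ω_support := fun k => hsupp (hpD k)
      τ_surjective := by
        rintro ⟨y, z⟩
        obtain ⟨x, hx⟩ := surjective_dotProduct_of_disjoint_support ht
          (fun k l hkl => (hD k l hkl).mono (htD k) (htD l)) z
        have hτ₀' : τ₀ ⬝ᵥ τ₀ ≠ 0 := fun h => hτ₀ (dotProduct_self_eq_zero.1 h)
        refine ⟨Sum.elim ((y / (τ₀ ⬝ᵥ τ₀)) • τ₀) x, ?_⟩
        have hy : ∑ k, τ₀ k * ((y / (τ₀ ⬝ᵥ τ₀)) • τ₀) k = y := by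
          change τ₀ ⬝ᵥ ((y / (τ₀ ⬝ᵥ τ₀)) • τ₀) = y
          rw [dotProduct_smul, smul_eq_mul]
          field_simp
        ext k
        · exact hy
        · simpa only [hdot, Sum.elim_comp_inr] using congrFun hx k
      ω_surjective := by
        intro z
        obtain ⟨x, hx⟩ := surjective_dotProduct_of_disjoint_support hp
          (fun k l hkl => (hD k l hkl).mono (hpD k) (hpD l)) z
        refine ⟨Sum.elim 0 x, ?_⟩
        ext k
        simpa only [hdot, Sum.elim_comp_inr] using congrFun hx k
      α := 1
      β := 0
      lawR₀ := PU.map fun u => targetNoise A₀₀ τ₀ ⬝ᵥ (u ∘ Sum.inl)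
      lawR := fun k => PU.map fun u => pullback AΩΩ (t k) ⬝ᵥ (u ∘ Sum.inr)
      prob_lawR₀ := Measure.isProbabilityMeasure_map hmeas₀.aemeasurable
      prob_lawR := fun k => Measure.isProbabilityMeasure_map (hmeas k).aemeasurable }
  have hd : ∑ k, T.α k • T.causeVec k = tauBar A₀₀ A₀Ω τ₀ := by
    rw [← hsum]
    refine Finset.sum_congr rfl fun k _ => ?_
    ext s
    simp [T, LinearReduction.causeVec]
  refine ⟨T, (T.consistencyLoss_eq_zero_iff h₀ h₁ hΩ hprior).2 ⟨hd, fun k => rfl, ?_⟩,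
    fun _ => rfl, fun _ => rfl, fun _ => rfl, fun _ => rfl⟩
  have hind : IndepFun (fun u : m ⊕ w → ℝ => targetNoise A₀₀ τ₀ ⬝ᵥ (u ∘ Sum.inl))
      (fun u k => pullback AΩΩ (t k) ⬝ᵥ (u ∘ Sum.inr)) PU :=
    hblocks.comp (φ := fun x => targetNoise A₀₀ τ₀ ⬝ᵥ x)
      (ψ := fun x k => pullback AΩΩ (t k) ⬝ᵥ x)
      (by unfold dotProduct; fun_prop) (by unfold dotProduct; fun_prop)
  have hres : ⇑(T.residual A₀₀ A₀Ω AΩΩ) = fun u => (targetNoise A₀₀ τ₀ ⬝ᵥ (u ∘ Sum.inl),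
      fun k => pullback AΩΩ (t k) ⬝ᵥ (u ∘ Sum.inr)) := funext fun u => T.residual_apply hd u
  rw [hres, (indepFun_iff_map_prod_eq_prod_map_map hmeas₀.aemeasurable
    (measurable_pi_lambda _ hmeas).aemeasurable).1 hind,
    (iIndepFun_iff_map_fun_eq_pi_map fun k => (hmeas k).aemeasurable).1 hindep]
  simp [LinearReduction.noiseLaw, T]

end Construction

end Consistent

/-! ### Reductions with several causes -/

section Independence

variable {m w : Type*} [Fintype m] [Fintype w]

/-- Linear functionals of independent jointly Gaussian variables that involve disjoint sets of
variables are uncorrelated, hence independent. -/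
lemma iIndepFun_dotProduct {PU : Measure (m ⊕ w → ℝ)} [IsGaussian PU]
    (hU : iIndepFun (fun (k : w) (u : m ⊕ w → ℝ) => u (Sum.inr k)) PU) {n : ℕ}
    {p : Fin n → w → ℝ}
    (hp : ∀ k l, k ≠ l → Disjoint (Function.support (p k)) (Function.support (p l))) :
    iIndepFun (fun k (u : m ⊕ w → ℝ) => p k ⬝ᵥ (u ∘ Sum.inr)) PU := by
  let L : (m ⊕ w → ℝ) →ₗ[ℝ] (Fin n → ℝ) :=
    (Matrix.of p).mulVecLin ∘ₗ LinearMap.funLeft ℝ ℝ Sum.inr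
  have hL : IsGaussian (PU.map L) := isGaussian_map (μ := PU) L.toContinuousLinearMap
  have hmem (r : w) : MemLp (fun u : m ⊕ w → ℝ => u (Sum.inr r)) 2 PU :=
    IsGaussian.memLp_dual PU (ContinuousLinearMap.proj (R := ℝ) (Sum.inr r)) 2 (by simp)
  refine HasGaussianLaw.iIndepFun_of_covariance_eq_zero ⟨hL⟩ fun k l hkl => ?_
  simp only [dotProduct, Function.comp_apply]
  rw [covariance_fun_sum_fun_sum (fun r => (hmem r).const_mul _) fun r => (hmem r).const_mul _]
  refine Finset.sum_eq_zero fun r _ => Finset.sum_eq_zero fun s _ => ?_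
  rw [covariance_const_mul_left, covariance_const_mul_right]
  by_cases hrs : r = s
  · subst hrs
    by_cases h : p k r = 0
    · simp [h]
    · have : p l r = 0 := by
        by_contra h'
        exact Set.disjoint_left.1 (hp k l hkl) h h'
      simp [this]
  · rw [(hU.indepFun hrs).covariance_eq_zero (hmem r) (hmem s)]
    simp

end Independence

variable {m w : Type*} [Fintype m] [Fintype w]

namespace LinearReduction

variable {τ₀ : m → ℝ} {n : ℕ} (T : LinearReduction (w := w) τ₀ n)

/-- The intervened variables that are aligned with the `k`-th cause. -/
def block (k : Fin n) : Set w := Sum.inr ⁻¹' T.π k.succ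

lemma block_unique {k l : Fin n} {s : w} (hk : s ∈ T.block k) (hl : s ∈ T.block l) : k = l := by
  by_contra h
  exact Set.disjoint_left.1 (T.π_disjoint k.succ l.succ fun e => h (Fin.succ_injective _ e)) hk hl

lemma mem_block_of_causeVec_ne_zero {k : Fin n} {s : w} (h : T.causeVec k s ≠ 0) :
    s ∈ T.block k := T.τ_support k h

lemma mem_block_of_shiftVec_ne_zero {k : Fin n} {s : w} (h : T.shiftVec k s ≠ 0) :
    s ∈ T.block k := T.ω_support k h

lemma le_card (T : LinearReduction (w := w) τ₀ n) : n ≤ Fintype.card w := by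
  have h (k : Fin n) : ∃ s, T.causeVec k s ≠ 0 := Function.ne_iff.1 (T.causeVec_ne_zero k)
  choose s hs using h
  have hinj : Function.Injective s := fun k l e =>
    T.block_unique (T.mem_block_of_causeVec_ne_zero (hs k))
      (e ▸ T.mem_block_of_causeVec_ne_zero (hs l))
  simpa using Fintype.card_le_of_injective s hinj

variable {T} {t : w → ℝ}

lemma α_mul_causeVec_of_mem (hd : ∑ k, T.α k • T.causeVec k = t) {k : Fin n} {s : w}
    (hs : s ∈ T.block k) : T.α k * T.causeVec k s = t s := by
  rw [← hd, Finset.sum_apply, Finset.sum_eq_single k]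
  · simp
  · intro l _ hl
    have : T.causeVec l s = 0 := by
      by_contra h
      exact hl (T.block_unique (T.mem_block_of_causeVec_ne_zero h) hs)
    simp [this]
  · simp

lemma causeVec_of_notMem {k : Fin n} {s : w} (hs : s ∉ T.block k) : T.causeVec k s = 0 := by
  by_contra h
  exact hs (T.mem_block_of_causeVec_ne_zero h)

lemma exists_mem_block (hd : ∑ k, T.α k • T.causeVec k = t) {s : w} (hs : t s ≠ 0) :
    ∃ k, s ∈ T.block k := by
  rw [← hd, Finset.sum_apply] at hs
  obtain ⟨k, -, hk⟩ := Finset.exists_ne_zero_of_sum_ne_zero hs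
  exact ⟨k, T.mem_block_of_causeVec_ne_zero (right_ne_zero_of_mul hk)⟩

lemma exists_mem_block_ne_zero (hd : ∑ k, T.α k • T.causeVec k = t) (hα : T.AllCausesActive)
    (k : Fin n) : ∃ s ∈ T.block k, t s ≠ 0 := by
  obtain ⟨s, hs⟩ := Function.ne_iff.1 (T.causeVec_ne_zero k)
  have hmem := T.mem_block_of_causeVec_ne_zero hs
  refine ⟨s, hmem, ?_⟩
  rw [← α_mul_causeVec_of_mem hd hmem]
  exact mul_ne_zero (hα k) hs

end LinearReduction

variable [DecidableEq m] [DecidableEq w]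
  {A₀₀ : Matrix m m ℝ} {A₀Ω : Matrix m w ℝ} {AΩΩ : Matrix w w ℝ} {τ₀ : m → ℝ}

variable (A₀₀ A₀Ω AΩΩ τ₀) in
/-- The variable `s` together with the variables that influence the target along pathways that leave
`Ω` through `s`. Under the absence of cancellations, a cause that depends on `X s` has to be aligned
with all of these. -/
def reach (s : w) : Set w := {r | r = s ∨ pathwayInfluence A₀₀ A₀Ω AΩΩ τ₀ r s ≠ 0}

lemma LinearReduction.reach_subset_block (hcanc : NoCancellation A₀₀ A₀Ω AΩΩ τ₀) {n : ℕ}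
    {T : LinearReduction (w := w) τ₀ n}
    (hd : ∑ k, T.α k • T.causeVec k = tauBar A₀₀ A₀Ω τ₀)
    (hω : ∀ k, T.shiftVec k = pullback AΩΩ (T.causeVec k)) {k : Fin n} {s : w}
    (hs : s ∈ T.block k) : reach A₀₀ A₀Ω AΩΩ τ₀ s ⊆ T.block k := by
  classical
  rintro r (rfl | hr)
  · exact hs
  apply T.mem_block_of_shiftVec_ne_zero
  have hsum : T.α k * T.shiftVec k r =
      ∑ s' with s' ∈ T.block k ∧ pathwayInfluence A₀₀ A₀Ω AΩΩ τ₀ r s' ≠ 0,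
        pathwayInfluence A₀₀ A₀Ω AΩΩ τ₀ r s' := by
    rw [hω, pullback, mulVec, dotProduct, Finset.mul_sum, Finset.sum_filter]
    refine Finset.sum_congr rfl fun s' _ => ?_
    by_cases hs' : s' ∈ T.block k
    · by_cases h0 : pathwayInfluence A₀₀ A₀Ω AΩΩ τ₀ r s' = 0
      · rw [if_neg (by simp [h0]), ← h0, pathwayInfluence, ← α_mul_causeVec_of_mem hd hs',
          transpose_apply]
        ring
      · rw [if_pos ⟨hs', h0⟩, pathwayInfluence, ← α_mul_causeVec_of_mem hd hs', transpose_apply]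
        ring
    · rw [if_neg (by simp [hs']), causeVec_of_notMem hs', mul_zero, mul_zero]
  -- Up to the factor `α k`, the entry of the intervention vector at `r` is the total coefficient of
  -- the pathways from `r` through the block, which cannot cancel.
  refine right_ne_zero_of_mul (a := T.α k) ?_
  rw [hsum]
  exact hcanc r _ ⟨s, by simp [hs, hr]⟩ fun s' hs' => (Finset.mem_filter.1 hs').2.2

/-- A labelling of the variables by causes such that variables with different labels have disjoint
reaches gives a consistent reduction: the causes are the restrictions of `tauBar` to the labels. -/
lemma exists_consistent_reduction_of_label (h₀ : IsUnit (1 - A₀₀).det)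
    (h₁ : IsUnit (1 - AΩΩ).det) {PU : Measure (m ⊕ w → ℝ)} [IsGaussian PU]
    (hblocks : IndepFun (fun (u : m ⊕ w → ℝ) (k : m) => u (Sum.inl k))
      (fun (u : m ⊕ w → ℝ) (k : w) => u (Sum.inr k)) PU)
    (hU : iIndepFun (fun (k : w) (u : m ⊕ w → ℝ) => u (Sum.inr k)) PU)
    {P : Measure (m ⊕ w → ℝ)} [IsProbabilityMeasure P]
    (hΩ : intervenedSet P = Set.range Sum.inr) (hprior : DensityPrior P ∨ AtomicPrior P)
    (hτ₀ : τ₀ ≠ 0) {n : ℕ} (c : w → Fin n)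
    (hc : ∀ k, ∃ s, tauBar A₀₀ A₀Ω τ₀ s ≠ 0 ∧ c s = k)
    (hsep : ∀ s s', tauBar A₀₀ A₀Ω τ₀ s ≠ 0 → tauBar A₀₀ A₀Ω τ₀ s' ≠ 0 → c s ≠ c s' →
      Disjoint (reach A₀₀ A₀Ω AΩΩ τ₀ s) (reach A₀₀ A₀Ω AΩΩ τ₀ s')) :
    ∃ T : LinearReduction (w := w) τ₀ n, T.AllCausesActive ∧
      T.consistencyLoss (fromBlocks A₀₀ A₀Ω 0 AΩΩ) PU P = 0 := by
  let t : Fin n → w → ℝ := fun k s => if c s = k then tauBar A₀₀ A₀Ω τ₀ s else 0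
  let D : Fin n → Set w :=
    fun k => {r | ∃ s, tauBar A₀₀ A₀Ω τ₀ s ≠ 0 ∧ c s = k ∧ r ∈ reach A₀₀ A₀Ω AΩΩ τ₀ s}
  have hD (k l) (hkl : k ≠ l) : Disjoint (D k) (D l) := by
    rw [Set.disjoint_left]
    rintro r ⟨s, hs, rfl, hr⟩ ⟨s', hs', rfl, hr'⟩
    exact Set.disjoint_left.1 (hsep s s' hs hs' hkl) hr hr'
  have hpD (k) : Function.support (pullback AΩΩ (t k)) ⊆ D k := by
    intro r hr
    obtain ⟨s, -, hs⟩ := Finset.exists_ne_zero_of_sum_ne_zero hr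
    have hG := left_ne_zero_of_mul hs
    have ht := right_ne_zero_of_mul hs
    have hcs : c s = k := by
      by_contra h
      simp [t, h] at ht
    have hτs : tauBar A₀₀ A₀Ω τ₀ s ≠ 0 := by simpa [t, hcs] using ht
    exact ⟨s, hτs, hcs, Or.inr (mul_ne_zero hτs hG)⟩
  obtain ⟨T, hT, hα, -⟩ := exists_consistent_reduction (A₀Ω := A₀Ω) h₀ h₁ hblocks hΩ
    hprior hτ₀ D hD t
    (fun k h => by
      obtain ⟨s, hs, hsk⟩ := hc k
      exact hs (by simpa [t, hsk] using congrFun h s))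
    (fun k s hs => by
      have hcs : c s = k := by
        by_contra h
        simp [t, h] at hs
      exact ⟨s, by simpa [t, hcs] using hs, hcs, Or.inl rfl⟩)
    hpD
    (by ext s; simp [t])
    (iIndepFun_dotProduct hU fun k l hkl => (hD k l hkl).mono (hpD k) (hpD l))
  exact ⟨T, fun k => by simp [hα], hT⟩

section Maximal

variable {n : ℕ} {T T' : LinearReduction (w := w) τ₀ n}

/-- In a reduction with the maximal number of causes no block meets two blocks of another consistent
reduction in the support of `tauBar`: otherwise the block could be split. -/
lemma mem_block_of_maximal (h₀ : IsUnit (1 - A₀₀).det)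
    (h₁ : IsUnit (1 - AΩΩ).det) {PU : Measure (m ⊕ w → ℝ)} [IsGaussian PU]
    (hblocks : IndepFun (fun (u : m ⊕ w → ℝ) (k : m) => u (Sum.inl k))
      (fun (u : m ⊕ w → ℝ) (k : w) => u (Sum.inr k)) PU)
    (hU : iIndepFun (fun (k : w) (u : m ⊕ w → ℝ) => u (Sum.inr k)) PU)
    {P : Measure (m ⊕ w → ℝ)} [IsProbabilityMeasure P]
    (hΩ : intervenedSet P = Set.range Sum.inr) (hprior : DensityPrior P ∨ AtomicPrior P)
    (hτ₀ : τ₀ ≠ 0) (hcanc : NoCancellation A₀₀ A₀Ω AΩΩ τ₀)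
    (hmax : ¬ ∃ T : LinearReduction (w := w) τ₀ (n + 1), T.AllCausesActive ∧
      T.consistencyLoss (fromBlocks A₀₀ A₀Ω 0 AΩΩ) PU P = 0)
    (hα : T.AllCausesActive) (hT : T.consistencyLoss (fromBlocks A₀₀ A₀Ω 0 AΩΩ) PU P = 0)
    (hT' : T'.consistencyLoss (fromBlocks A₀₀ A₀Ω 0 AΩΩ) PU P = 0)
    {k l : Fin n} {s s' : w} (hs : tauBar A₀₀ A₀Ω τ₀ s ≠ 0) (hs' : tauBar A₀₀ A₀Ω τ₀ s' ≠ 0)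
    (hk : s ∈ T.block k) (hk' : s' ∈ T.block k) (hl : s ∈ T'.block l) : s' ∈ T'.block l := by
  classical
  obtain ⟨hd, hω, -⟩ := (T.consistencyLoss_eq_zero_iff h₀ h₁ hΩ hprior).1 hT
  obtain ⟨hd', hω', -⟩ := (T'.consistencyLoss_eq_zero_iff h₀ h₁ hΩ hprior).1 hT'
  by_contra hl'
  have hlabel (r : w) : ∃ j, tauBar A₀₀ A₀Ω τ₀ r ≠ 0 → r ∈ T.block j := by
    by_cases hr : tauBar A₀₀ A₀Ω τ₀ r = 0
    · exact ⟨k, fun h => absurd hr h⟩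
    · obtain ⟨j, hj⟩ := LinearReduction.exists_mem_block hd hr
      exact ⟨j, fun _ => hj⟩
  choose c hc using hlabel
  -- The part of the `k`-th block inside the `l`-th block of `T'` becomes an additional cause.
  refine hmax (exists_consistent_reduction_of_label h₀ h₁ hblocks hU hΩ hprior hτ₀
    (fun r => if r ∈ T.block k ∧ r ∈ T'.block l then Fin.last n else (c r).castSucc) ?_ ?_)
  · intro j
    cases j using Fin.lastCases with
    | last => exact ⟨s, hs, if_pos ⟨hk, hl⟩⟩
    | cast j =>
      by_cases hjk : j = k
      · subst hjk
        refine ⟨s', hs', ?_⟩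
        rw [if_neg fun h => hl' h.2, T.block_unique (hc s' hs') hk']
      · obtain ⟨r, hr, hr0⟩ := LinearReduction.exists_mem_block_ne_zero hd hα j
        refine ⟨r, hr0, ?_⟩
        rw [if_neg fun h => hjk (T.block_unique hr h.1), T.block_unique (hc r hr0) hr]
  · intro r r' hr hr' hne
    by_cases hcr : c r = c r'
    · -- The labels differ only through the blocks of the second reduction.
      obtain ⟨j, hj⟩ := LinearReduction.exists_mem_block hd' hr
      obtain ⟨j', hj'⟩ := LinearReduction.exists_mem_block hd' hr'
      have hjj' : j ≠ j' := by
        rintro rfl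
        refine hne ?_
        have hmem : r ∈ T.block k ↔ r' ∈ T.block k :=
          ⟨fun h => T.block_unique (hc r hr) h ▸ hcr ▸ hc r' hr',
            fun h => T.block_unique (hc r' hr') h ▸ hcr ▸ hc r hr⟩
        have hmem' : r ∈ T'.block l ↔ r' ∈ T'.block l :=
          ⟨fun h => T'.block_unique hj h ▸ hj', fun h => T'.block_unique hj' h ▸ hj⟩
        simp only [hmem, hmem', hcr]
      refine Set.disjoint_left.2 fun x hx hx' => hjj' (T'.block_unique (s := x) ?_ ?_)
      · exact LinearReduction.reach_subset_block hcanc hd' hω' hj hx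
      · exact LinearReduction.reach_subset_block hcanc hd' hω' hj' hx'
    · refine Set.disjoint_left.2 fun x hx hx' => hcr (T.block_unique (s := x) ?_ ?_)
      · exact LinearReduction.reach_subset_block hcanc hd hω (hc r hr) hx
      · exact LinearReduction.reach_subset_block hcanc hd hω (hc r' hr') hx'

/-- With a maximal number of causes, the blocks of two consistent reductions cut the support of
`tauBar` into the same parts: each block of `T` lies in a block of `T'` there, and this defines a
surjective, hence bijective, map between the causes. -/
theorem equivUpToScalingAndPerm_of_maximal (h₀ : IsUnit (1 - A₀₀).det)
    (h₁ : IsUnit (1 - AΩΩ).det) {PU : Measure (m ⊕ w → ℝ)} [IsGaussian PU]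
    (hblocks : IndepFun (fun (u : m ⊕ w → ℝ) (k : m) => u (Sum.inl k))
      (fun (u : m ⊕ w → ℝ) (k : w) => u (Sum.inr k)) PU)
    (hU : iIndepFun (fun (k : w) (u : m ⊕ w → ℝ) => u (Sum.inr k)) PU)
    {P : Measure (m ⊕ w → ℝ)} [IsProbabilityMeasure P]
    (hΩ : intervenedSet P = Set.range Sum.inr) (hprior : DensityPrior P ∨ AtomicPrior P)
    (hτ₀ : τ₀ ≠ 0) (hcanc : NoCancellation A₀₀ A₀Ω AΩΩ τ₀)
    (hmax : ¬ ∃ T : LinearReduction (w := w) τ₀ (n + 1), T.AllCausesActive ∧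
      T.consistencyLoss (fromBlocks A₀₀ A₀Ω 0 AΩΩ) PU P = 0)
    (hα : T.AllCausesActive) (hT : T.consistencyLoss (fromBlocks A₀₀ A₀Ω 0 AΩΩ) PU P = 0)
    (hα' : T'.AllCausesActive) (hT' : T'.consistencyLoss (fromBlocks A₀₀ A₀Ω 0 AΩΩ) PU P = 0) :
    T.EquivUpToScalingAndPerm T' := by
  obtain ⟨hd, -⟩ := (T.consistencyLoss_eq_zero_iff h₀ h₁ hΩ hprior).1 hT
  obtain ⟨hd', -⟩ := (T'.consistencyLoss_eq_zero_iff h₀ h₁ hΩ hprior).1 hT'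
  have hf (k : Fin n) : ∃ l, ∀ s ∈ T.block k, tauBar A₀₀ A₀Ω τ₀ s ≠ 0 → s ∈ T'.block l := by
    obtain ⟨s, hs, hs0⟩ := LinearReduction.exists_mem_block_ne_zero hd hα k
    obtain ⟨l, hl⟩ := LinearReduction.exists_mem_block hd' hs0
    exact ⟨l, fun s' hs' hs0' => mem_block_of_maximal h₀ h₁ hblocks hU hΩ hprior hτ₀ hcanc hmax
      hα hT hT' hs0 hs0' hs hs' hl⟩
  choose f hf using hf
  have hsurj : Function.Surjective f := by
    intro l
    obtain ⟨s, hs, hs0⟩ := LinearReduction.exists_mem_block_ne_zero hd' hα' l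
    obtain ⟨k, hk⟩ := LinearReduction.exists_mem_block hd hs0
    exact ⟨k, T'.block_unique (hf k s hk hs0) hs⟩
  let σ : Equiv.Perm (Fin n) :=
    (Equiv.ofBijective f ⟨Finite.injective_iff_surjective.2 hsurj, hsurj⟩).symm
  have hfσ (k : Fin n) : f (σ k) = k := Equiv.ofBijective_apply_symm_apply f _ k
  have hσf (k : Fin n) : σ (f k) = k := Equiv.ofBijective_symm_apply_apply f _ k
  have hblock (k : Fin n) {s : w} (hs : tauBar A₀₀ A₀Ω τ₀ s ≠ 0) :
      s ∈ T.block (σ k) ↔ s ∈ T'.block k := by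
    refine ⟨fun h => hfσ k ▸ hf (σ k) s h hs, fun h => ?_⟩
    obtain ⟨j, hj⟩ := LinearReduction.exists_mem_block hd hs
    rw [← T'.block_unique (hf j s hj hs) h, hσf]
    exact hj
  have hvec (k : Fin n) (s : w) : T'.α k * T'.causeVec k s = T.α (σ k) * T.causeVec (σ k) s := by
    by_cases hs : tauBar A₀₀ A₀Ω τ₀ s = 0
    · have hzero {S : LinearReduction (w := w) τ₀ n}
          (hS : ∑ k, S.α k • S.causeVec k = tauBar A₀₀ A₀Ω τ₀) (j : Fin n) :
          S.α j * S.causeVec j s = 0 := by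
        by_cases hj : s ∈ S.block j
        · rw [LinearReduction.α_mul_causeVec_of_mem hS hj, hs]
        · rw [LinearReduction.causeVec_of_notMem hj, mul_zero]
      rw [hzero hd, hzero hd']
    · by_cases hj : s ∈ T'.block k
      · rw [LinearReduction.α_mul_causeVec_of_mem hd' hj,
          LinearReduction.α_mul_causeVec_of_mem hd ((hblock k hs).2 hj)]
      · rw [LinearReduction.causeVec_of_notMem hj,
          LinearReduction.causeVec_of_notMem fun h => hj ((hblock k hs).1 h), mul_zero, mul_zero]
  refine LinearReduction.equivUpToScalingAndPerm_of_causeVec h₀ h₁ hΩ hprior hT hT' σ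
    (fun k => T.α (σ k) / T'.α k) (fun k => div_ne_zero (hα _) (hα' k)) (fun k => ?_) fun k => ?_
  · ext s
    have := hα' k
    rw [Pi.smul_apply, smul_eq_mul, div_mul_eq_mul_div, ← hvec]
    field_simp
  · have := hα' k
    field_simp

end Maximal

/-- The explicit reduction to a single cause, and its uniqueness. -/
theorem exists_one_cause_reduction (h₀ : IsUnit (1 - A₀₀).det)
    (h₁ : IsUnit (1 - AΩΩ).det) {PU : Measure (m ⊕ w → ℝ)} [IsGaussian PU]
    (hblocks : IndepFun (fun (u : m ⊕ w → ℝ) (k : m) => u (Sum.inl k))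
      (fun (u : m ⊕ w → ℝ) (k : w) => u (Sum.inr k)) PU)
    {P : Measure (m ⊕ w → ℝ)} [IsProbabilityMeasure P]
    (hΩ : intervenedSet P = Set.range Sum.inr) (hprior : DensityPrior P ∨ AtomicPrior P)
    (hτ₀ : τ₀ ≠ 0) (hτ : tauBar A₀₀ A₀Ω τ₀ ≠ 0) :
    ∃ T : LinearReduction (w := w) τ₀ 1,
      T.AllCausesActive ∧
      T.consistencyLoss (fromBlocks A₀₀ A₀Ω 0 AΩΩ) PU P = 0 ∧
      T.π 1 = Set.range Sum.inr ∧
      (∀ k, T.τ 0 (Sum.inr k) = tauBar A₀₀ A₀Ω τ₀ k) ∧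
      (∀ k, T.ω 0 (Sum.inr k) = omegaBar A₀₀ A₀Ω AΩΩ τ₀ k) ∧
      ∀ T' : LinearReduction (w := w) τ₀ 1,
        T'.consistencyLoss (fromBlocks A₀₀ A₀Ω 0 AΩΩ) PU P = 0 → T.EquivUpToScalingAndPerm T' := by
  obtain ⟨T, hT, hα, hπ, hcause, hshift⟩ := exists_consistent_reduction (A₀Ω := A₀Ω) h₀ h₁
    hblocks hΩ hprior hτ₀ (n := 1) (fun _ => Set.univ) (fun k l h => absurd (Subsingleton.elim k l) h)
    (fun _ => tauBar A₀₀ A₀Ω τ₀) (fun _ => hτ) (fun _ => Set.subset_univ _)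
    (fun _ => Set.subset_univ _) (by simp) iIndepFun.of_subsingleton
  refine ⟨T, fun k => by simp [hα], hT, by simpa using hπ 0, fun k => congrFun (hcause 0) k,
    fun k => congrFun (hshift 0) k, fun T' hT' => ?_⟩
  have hd' := ((T'.consistencyLoss_eq_zero_iff h₀ h₁ hΩ hprior).1 hT').1
  rw [Fin.sum_univ_one] at hd'
  have hα' : T'.α 0 ≠ 0 := by
    intro h
    exact hτ (by rw [← hd', h, zero_smul])
  refine LinearReduction.equivUpToScalingAndPerm_of_causeVec h₀ h₁ hΩ hprior hT hT' 1
    (fun _ => (T'.α 0)⁻¹) (fun _ => inv_ne_zero hα') (fun k => ?_) fun k => ?_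
  · rw [Subsingleton.elim k 0, hcause, ← hd', smul_smul, inv_mul_cancel₀ hα', one_smul]
  · rw [Subsingleton.elim k 0, hα, mul_inv_cancel₀ hα']

end TCR

theorem proposition2 {m w : Type*} [Fintype m] [Fintype w] [DecidableEq m] [DecidableEq w]
    (A₀₀ : Matrix m m ℝ) (A₀Ω : Matrix m w ℝ) (AΩΩ : Matrix w w ℝ)
    (A : Matrix (m ⊕ w) (m ⊕ w) ℝ) (hA : A = Matrix.fromBlocks A₀₀ A₀Ω 0 AΩΩ)
    -- the exogenous variables: jointly Gaussian, the two blocks independent of each other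
    (PU : Measure (m ⊕ w → ℝ)) (hPU : IsGaussian PU)
    (μ : m ⊕ w → ℝ) (σ : m ⊕ w → ℝ≥0) (hσ : ∀ k, 0 < σ k)
    (hmarginal : ∀ k, PU.map (fun u => u k) = gaussianReal (μ k) (σ k ^ 2))
    (hblocks : IndepFun (fun (u : m ⊕ w → ℝ) (k : m) => u (Sum.inl k))
      (fun (u : m ⊕ w → ℝ) (k : w) => u (Sum.inr k)) PU)
    (hsolv : TCR.UniquelySolvable A PU)
    -- the prior of the interventions, with `Ω` the set of intervened variables
    (P : Measure (m ⊕ w → ℝ)) (hP : IsProbabilityMeasure P)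
    (hΩ : TCR.intervenedSet P = Set.range Sum.inr)
    (hprior : TCR.DensityPrior P ∨ TCR.AtomicPrior P)
    -- the linear target, which is influenced by the intervened variables
    (τ₀ : m → ℝ) (hτ : TCR.tauBar A₀₀ A₀Ω τ₀ ≠ 0) :
    -- existence, the explicit form, and uniqueness up to scaling of the 1-cause reduction
    (∃ T : TCR.LinearReduction (w := w) τ₀ 1,
      T.consistencyLoss A PU P = 0 ∧
      T.π 1 = Set.range Sum.inr ∧
      (∀ k, T.τ 0 (Sum.inr k) = TCR.tauBar A₀₀ A₀Ω τ₀ k) ∧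
      (∀ k, T.ω 0 (Sum.inr k) = TCR.omegaBar A₀₀ A₀Ω AΩΩ τ₀ k) ∧
      ∀ T' : TCR.LinearReduction (w := w) τ₀ 1,
        T'.consistencyLoss A PU P = 0 → T.EquivUpToScalingAndPerm T') ∧
    -- the maximal number of causes, and uniqueness of the reduction with that number of causes
    ∃ nmax : ℕ,
      IsGreatest {n : ℕ | ∃ T : TCR.LinearReduction (w := w) τ₀ n,
        T.AllCausesActive ∧ T.consistencyLoss A PU P = 0} nmax ∧
      (iIndepFun (fun (k : w) (u : m ⊕ w → ℝ) => u (Sum.inr k)) PU →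
        TCR.NoCancellation A₀₀ A₀Ω AΩΩ τ₀ →
        ∀ T T' : TCR.LinearReduction (w := w) τ₀ nmax,
          T.AllCausesActive → T.consistencyLoss A PU P = 0 →
          T'.AllCausesActive → T'.consistencyLoss A PU P = 0 →
          T.EquivUpToScalingAndPerm T')
    := by
  subst hA
  obtain ⟨h₀, h₁⟩ := TCR.isUnit_det_one_sub_fromBlocks.1 hsolv.isUnit_det
  have hτ₀ : τ₀ ≠ 0 := by
    rintro rfl
    exact hτ (by simp [TCR.tauBar])
  obtain ⟨T, hα, hT⟩ := TCR.exists_one_cause_reduction (AΩΩ := AΩΩ) h₀ h₁ hblocks hΩ hprior hτ₀ hτ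
  refine ⟨⟨T, hT⟩, ?_⟩
  let N : Set ℕ := {n : ℕ | ∃ T : TCR.LinearReduction (w := w) τ₀ n,
    T.AllCausesActive ∧ T.consistencyLoss (Matrix.fromBlocks A₀₀ A₀Ω 0 AΩΩ) PU P = 0}
  have hne : N.Nonempty := ⟨1, T, hα, hT.1⟩
  have hbdd : BddAbove N := ⟨Fintype.card w, fun n ⟨T, _⟩ => T.le_card⟩
  refine ⟨sSup N, ⟨Nat.sSup_mem hne hbdd, fun n hn => le_csSup hbdd hn⟩, ?_⟩
  intro hU hcanc S S' hα hS hα' hS'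
  refine TCR.equivUpToScalingAndPerm_of_maximal h₀ h₁ hblocks hU hΩ hprior hτ₀ hcanc ?_
    hα hS hα' hS'
  intro h
  exact absurd (le_csSup hbdd h) (by simp)
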